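/- Let $G$ be a finite simple graph that contains a cycle. A tree-decomposition of $G$ is a pair $(T,(V_t)_{t\in T})$ of a finite tree $T$ and sets $V_t\subseteq V(G)$, its parts, one for every node $t$ of $T$, such that every vertex of $G$ lies in some part, both ends of every edge of $G$ lie in a common part, and $V_{t_1}\cap V_{t_3}\subseteq V_{t_2}$ whenever $t_2$ lies on the path in $T$ between $t_1$ and $t_3$. Its width is $\max_{t\in T}(|V_t|-1)$, and the tree-width $\mathrm{tw}(G)$ is the minimum width of a tree-decomposition of $G$. The weak connected tree-width $\mathrm{wctw}(G)$ is the least $k\in\mathbb{N}$ for which $G$ has a tree-decomposition such that every part is contained in a set of at most $k+1$ vertices that induces a connected subgraph of $G$. Let $\ell(G)$ be the least natural number $\ell$ such that the (edge sets of) cycles of $G$ of length at most $\ell$ generate the cycle space of $G$, i.e. the subspace over $\mathbb{F}_2$ of the edge space of $G$ that is spanned by the edge sets of all cycles of $G$. Then \[ \mathrm{wctw}(G)\le \mathrm{tw}(G)\left\lfloor\frac{\ell(G)}{2}\right\rfloor . \] -/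

import Mathlib

universe u v

namespace SimpleGraph

/-- A tree-decomposition of `G` over the node set `ι`. -/
structure TreeDecomposition {V : Type u} (G : SimpleGraph V) (ι : Type v) where
  /-- The decomposition tree. -/
  tree : SimpleGraph ι
  isTree : tree.IsTree
  /-- The part at a node. -/
  part : ι → Set V
  /-- (T1) every vertex lies in some part. -/
  exists_mem_part : ∀ x : V, ∃ t, x ∈ part t
  /-- (T2) both ends of every edge lie in a common part. -/
  exists_edge_mem_part : ∀ x y : V, G.Adj x y → ∃ t, x ∈ part t ∧ y ∈ part t
  /-- (T3) `V_{t₁} ∩ V_{t₃} ⊆ V_{t₂}` whenever `t₂` lies on the `t₁`–`t₃` path of the tree. -/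
  inter_subset_part : ∀ (t₁ t₂ t₃ : ι) (p : tree.Walk t₁ t₃), p.IsPath → t₂ ∈ p.support →
    part t₁ ∩ part t₃ ⊆ part t₂

/-- The width `max_t (|V_t| - 1)` of a tree-decomposition. It is used for finite non-empty graphs
and finite trees only, where the maximum exists and is attained at a non-empty part. -/
noncomputable def TreeDecomposition.width {V : Type u} {G : SimpleGraph V} {ι : Type v}
    (D : TreeDecomposition G ι) : ℕ :=
  ⨆ t, ((D.part t).ncard - 1)

/-- The tree-width: the least width of a tree-decomposition (over a finite tree). -/
noncomputable def treeWidth {V : Type u} (G : SimpleGraph V) : ℕ :=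
  sInf {w | ∃ (ι : Type u) (_ : Finite ι) (D : TreeDecomposition G ι), D.width = w}

/-- Every part is contained in a connected set of at most `k + 1` vertices. -/
def TreeDecomposition.IsWeaklyConnected {V : Type u} {G : SimpleGraph V} {ι : Type v}
    (D : TreeDecomposition G ι) (k : ℕ) : Prop :=
  ∀ t, ∃ S : Set V, D.part t ⊆ S ∧ (G.induce S).Connected ∧ S.ncard ≤ k + 1

/-- The weak connected tree-width: the least `k` such that some tree-decomposition (over a finite
tree) has every part contained in a connected set of at most `k + 1` vertices. -/
noncomputable def weakConnectedTreeWidth {V : Type u} (G : SimpleGraph V) : ℕ :=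
  sInf {k | ∃ (ι : Type u) (_ : Finite ι) (D : TreeDecomposition G ι), D.IsWeaklyConnected k}

/-- The edge set of a closed walk as a vector over `𝔽₂`. Edge vectors are functions on all
unordered pairs of vertices; those of walks in `G` vanish off the edges of `G`. -/
noncomputable def cycleVector {V : Type u} {G : SimpleGraph V} {x : V} (c : G.Walk x x) :
    Sym2 V → ZMod 2 :=
  Set.indicator {e | e ∈ c.edges} 1

/-- The cycle space of `G`: the subspace over `𝔽₂` spanned by the edge sets of all its cycles. -/
noncomputable def cycleSpace {V : Type u} (G : SimpleGraph V) :
    Submodule (ZMod 2) (Sym2 V → ZMod 2) :=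
  Submodule.span (ZMod 2) {f | ∃ (x : V) (c : G.Walk x x), c.IsCycle ∧ cycleVector c = f}

/-- The subspace spanned by the edge sets of the cycles of length at most `l`. -/
noncomputable def shortCycleSpace {V : Type u} (G : SimpleGraph V) (l : ℕ) :
    Submodule (ZMod 2) (Sym2 V → ZMod 2) :=
  Submodule.span (ZMod 2)
    {f | ∃ (x : V) (c : G.Walk x x), c.IsCycle ∧ c.length ≤ l ∧ cycleVector c = f}

/-- `ℓ(G)`: the least `l` such that the cycles of length at most `l` generate the cycle space. -/
noncomputable def cycleSpaceLength {V : Type u} (G : SimpleGraph V) : ℕ :=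
  sInf {l | G.shortCycleSpace l = G.cycleSpace}

/-- The minimum defining the tree-width of a finite graph exists. -/
theorem exists_width_eq_treeWidth {V : Type u} (G : SimpleGraph V) :
    ∃ (ι : Type u) (_ : Finite ι) (D : TreeDecomposition G ι), D.width = G.treeWidth := by
  refine Nat.sInf_mem (s := {w | ∃ (ι : Type u) (_ : Finite ι) (D : TreeDecomposition G ι),
    D.width = w}) ⟨_, PUnit, inferInstance, ?_, rfl⟩
  exact
    { tree := starGraph PUnit.unit
      isTree := isTree_starGraph _
      part := fun _ => Set.univ
      exists_mem_part := fun _ => ⟨PUnit.unit, trivial⟩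
      exists_edge_mem_part := fun _ _ _ => ⟨PUnit.unit, trivial, trivial⟩
      inter_subset_part := fun _ _ _ _ _ _ _ _ => trivial }

/-- The minimum defining the weak connected tree-width of a finite non-empty graph exists. -/
theorem exists_isWeaklyConnected {V : Type u} [Finite V] [Nonempty V] (G : SimpleGraph V) :
    ∃ (ι : Type u) (_ : Finite ι) (D : TreeDecomposition G ι),
      D.IsWeaklyConnected G.weakConnectedTreeWidth := by
  refine Nat.sInf_mem (s := {k | ∃ (ι : Type u) (_ : Finite ι) (D : TreeDecomposition G ι),
    D.IsWeaklyConnected k}) ⟨Nat.card V, G.ConnectedComponent, inferInstance, ?_⟩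
  have x₀ : V := Classical.arbitrary V
  refine ⟨{ tree := starGraph (G.connectedComponentMk x₀)
            isTree := isTree_starGraph _
            part := fun c => c.supp
            exists_mem_part := fun x => ⟨G.connectedComponentMk x, rfl⟩
            exists_edge_mem_part := fun x y h =>
              ⟨G.connectedComponentMk x, rfl, ConnectedComponent.sound h.reachable.symm⟩
            inter_subset_part := ?_ }, fun c => ⟨c.supp, subset_rfl, ?_, ?_⟩⟩
  · rintro t₁ t₂ t₃ p hp ht x ⟨h₁, h₃⟩
    have h : t₁ = t₃ := h₁.symm.trans h₃
    subst h
    rw [Walk.isPath_iff_eq_nil] at hp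
    subst hp
    have : t₂ = t₁ := by simpa using ht
    exact this ▸ h₁
  · exact c.connected_toSimpleGraph
  · exact (Set.ncard_le_card _).trans (Nat.le_succ _)

/-- The minimum defining `ℓ(G)` of a finite graph exists. -/
theorem shortCycleSpace_cycleSpaceLength {V : Type u} [Finite V] (G : SimpleGraph V) :
    G.shortCycleSpace G.cycleSpaceLength = G.cycleSpace := by
  have := Fintype.ofFinite V
  refine Nat.sInf_mem (s := {l | G.shortCycleSpace l = G.cycleSpace}) ⟨Fintype.card V, ?_⟩
  unfold shortCycleSpace cycleSpace
  congr 1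
  ext f
  refine ⟨fun ⟨x, c, h, _, e⟩ => ⟨x, c, h, e⟩, fun ⟨x, c, h, e⟩ => ⟨x, c, h, ?_, e⟩⟩
  have h1 := h.support_nodup.length_le_card
  simpa using h1

end SimpleGraph

/-! Among the tree-decompositions with parts of at most `G.treeWidth + 1` vertices, take one with
the fewest pairs of vertices in common parts. If two nonadjacent vertices of a part `K` attached to
no common component of `G - K`, the decomposition could be split at `K` so as to separate them,
losing a pair (`exists_attached_of_minimal`). If `K` is an inclusion-maximal part, no component of
`G - K` attaches to all of `K`, as otherwise a larger part would exist (`exists_part_of_attached`).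

These two facts link `K` by short walks: every proper nonempty `X ⊆ K` has a walk of length at most
`ℓ(G) / 2` to `K \ X` (`exists_short_walk_of_pairs_attached`). Indeed, a closed walk through two
components on either side of a separator can be made to cross from `X` into one of them exactly
once. Such crossings are even in number on every cycle that avoids either `X` or the rest of the
separator. As short cycles generate the cycle space, some short cycle meets both, and half of it is
the walk (`exists_short_walk_of_attached`).

Joining the vertices of `K` one by one by such walks gives a connected set of at most `(|K| - 1) *
(ℓ(G) / 2) + 1` vertices (`exists_connected_superset`). -/

namespace SimpleGraph

/-! ### Closed walks and the cycle space over `ZMod 2`. -/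

section ClosedWalks

variable {V : Type u} {G : SimpleGraph V}

/-- A `ZMod 2`-valued weight on edges that vanishes on all cycles vanishes on all closed walks. -/
theorem Walk.sum_edges_eq_zero_of_isCycle (f : Sym2 V → ZMod 2)
    (hf : ∀ (x : V) (c : G.Walk x x), c.IsCycle → (c.edges.map f).sum = 0)
    {x : V} (p : G.Walk x x) : (p.edges.map f).sum = 0 := by
  classical
  -- A path closed up by an edge is a cycle, unless the path is that edge itself; then the edge
  -- counts twice, which is zero mod 2.
  have close : ∀ {u v : V} (h : G.Adj u v) (q : G.Walk v u), q.IsPath →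
      f s(u, v) + (q.edges.map f).sum = 0 := by
    intro u v h q hq
    by_cases he : s(u, v) ∈ q.edges
    · have hl := hq.length_eq_one_of_mem_edges (Sym2.eq_swap ▸ he)
      obtain ⟨e, hq1⟩ := List.length_eq_one_iff.1 (q.length_edges.trans hl)
      rw [hq1, List.mem_singleton] at he
      simpa [hq1, ← he] using CharTwo.add_self_eq_zero _
    · simpa using hf u (Walk.cons h q) ((Walk.cons_isCycle_iff q h).2 ⟨hq, he⟩)
  -- Each piece that `bypass` deletes is an edge followed by a path back to its start, so `close`
  -- applies to it.
  have bypass : ∀ {u v : V} (q : G.Walk u v),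
      (q.bypass.edges.map f).sum = (q.edges.map f).sum := by
    intro u v q
    induction q with
    | nil => rfl
    | cons h q ih =>
      rw [Walk.bypass]
      split_ifs with hs
      · have h1 := close h (q.bypass.takeUntil _ hs) (q.bypass_isPath.takeUntil hs)
        have h2 := congrArg (fun r => (r.edges.map f).sum) (q.bypass.take_spec hs)
        simp only [Walk.edges_append, List.map_append, List.sum_append] at h2
        rw [Walk.edges_cons, List.map_cons, List.sum_cons, ← ih, ← h2, ← add_assoc, h1, zero_add]
      · simp [ih]
  rw [← bypass, Walk.edges_eq_nil.2 (Walk.isPath_iff_nil.1 p.bypass_isPath)]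
  rfl

theorem sum_mul_cycleVector [Fintype V] [DecidableEq V] (f : Sym2 V → ZMod 2) {x : V}
    {c : G.Walk x x} (hc : c.edges.Nodup) :
    ∑ e, f e * cycleVector c e = (c.edges.map f).sum := by
  classical
  rw [← List.sum_toFinset f hc]
  rw [← Finset.sum_subset (Finset.subset_univ c.edges.toFinset)]
  · refine Finset.sum_congr rfl fun e he => ?_
    have : e ∈ c.edges := by simpa using he
    simp [cycleVector, Set.indicator, this]
  · intro e _ he
    have : e ∉ c.edges := by simpa using he
    simp [cycleVector, Set.indicator, this]

/-- A weight that vanishes on the cycles of length at most `ℓ(G)` vanishes on closed walks. -/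
theorem Walk.sum_edges_eq_zero_of_short [Finite V] (f : Sym2 V → ZMod 2)
    (hf : ∀ (x : V) (c : G.Walk x x), c.IsCycle → c.length ≤ G.cycleSpaceLength →
      (c.edges.map f).sum = 0)
    {x : V} (p : G.Walk x x) : (p.edges.map f).sum = 0 := by
  classical
  have := Fintype.ofFinite V
  refine p.sum_edges_eq_zero_of_isCycle f fun y c hc => ?_
  -- Pairing with `f` is linear, so it vanishes on whatever the short cycles span.
  let Φ : (Sym2 V → ZMod 2) →ₗ[ZMod 2] ZMod 2 := ∑ e, f e • LinearMap.proj e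
  have hΦ : ∀ v, Φ v = ∑ e, f e * v e := fun v => by simp [Φ]
  have hle : G.shortCycleSpace G.cycleSpaceLength ≤ LinearMap.ker Φ := by
    refine Submodule.span_le.2 ?_
    rintro _ ⟨z, d, hd, hl, rfl⟩
    rw [SetLike.mem_coe, LinearMap.mem_ker, hΦ, sum_mul_cycleVector f hd.edges_nodup]
    exact hf z d hd hl
  have hmem : cycleVector c ∈ G.cycleSpace := Submodule.subset_span ⟨y, c, hc, rfl⟩
  rw [← shortCycleSpace_cycleSpaceLength] at hmem
  have := hle hmem
  rwa [LinearMap.mem_ker, hΦ, sum_mul_cycleVector f hc.edges_nodup] at this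

/-- No cycle is shorter than 3, so a smaller bound would generate only zero. The bound ensures that
a single edge counts as a short walk, `1 ≤ ℓ(G) / 2`. -/
theorem three_le_cycleSpaceLength [Finite V] {x : V} {c : G.Walk x x} (hc : c.IsCycle) :
    3 ≤ G.cycleSpaceLength := by
  by_contra hlt
  have h := shortCycleSpace_cycleSpaceLength G
  have hbot : G.shortCycleSpace G.cycleSpaceLength = ⊥ := by
    refine Submodule.span_eq_bot.2 ?_
    rintro _ ⟨y, d, hd, hl, -⟩
    have := hd.three_le_length
    omega
  have hmem : cycleVector c ∈ G.cycleSpace := Submodule.subset_span ⟨x, c, hc, rfl⟩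
  rw [← h, hbot, Submodule.mem_bot] at hmem
  cases c with
  | nil => exact hc.ne_nil rfl
  | cons hadj q =>
    rename_i y
    have := congrFun hmem s(x, y)
    simp [cycleVector, Set.indicator] at this

theorem Walk.exists_walk_length_le_half {x u v : V} (c : G.Walk x x)
    (hu : u ∈ c.support) (hv : v ∈ c.support) :
    ∃ p : G.Walk u v, p.length ≤ c.length / 2 := by
  classical
  have hv' : v ∈ (c.rotate u hu).support := (c.mem_support_rotate_iff u hu).2 hv
  have h1 := congrArg Walk.length ((c.rotate u hu).take_spec hv')
  rw [Walk.length_append, Walk.length_rotate] at h1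
  rcases le_total ((c.rotate u hu).takeUntil v hv').length ((c.rotate u hu).dropUntil v hv').length
    with h | h
  · exact ⟨(c.rotate u hu).takeUntil v hv', by omega⟩
  · exact ⟨((c.rotate u hu).dropUntil v hv').reverse, by rw [Walk.length_reverse]; omega⟩

end ClosedWalks

/-! ### Growing a connected set along short walks. -/

section Linked

variable {V : Type u} {G : SimpleGraph V}

/-- A set in which every proper nonempty subset is joined to the rest by a walk of length at most
`m` lies in a connected set of at most `(|K| - 1) * m + 1` vertices. -/
theorem exists_connected_superset [Finite V] {K : Set V} (hK : K.Nonempty) {m : ℕ}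
    (hlink : ∀ X ⊆ K, X.Nonempty → X ≠ K →
      ∃ x ∈ X, ∃ y ∈ K \ X, ∃ p : G.Walk x y, p.length ≤ m) :
    ∃ S : Set V, K ⊆ S ∧ (G.induce S).Connected ∧ S.ncard ≤ (K.ncard - 1) * m + 1 := by
  have key : ∀ n < K.ncard, ∃ X ⊆ K, X.ncard = n + 1 ∧ ∃ S : Set V, X ⊆ S ∧
      (G.induce S).Connected ∧ S.ncard ≤ n * m + 1 := by
    intro n
    induction n with
    | zero =>
      intro _
      obtain ⟨x, hx⟩ := hK
      exact ⟨{x}, by simpa using hx, by simp, {x}, subset_rfl,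
        by simp, by simp⟩
    | succ n ih =>
      intro hn
      obtain ⟨X, hXK, hXn, S, hXS, hS, hcard⟩ := ih (by omega)
      obtain ⟨x, hx, y, hy, p, hp⟩ := hlink X hXK
        ((Set.ncard_pos (Set.toFinite _)).1 (by omega)) (by rintro rfl; omega)
      refine ⟨insert y X, Set.insert_subset hy.1 hXK, ?_, S ∪ {v | v ∈ p.support}, ?_, ?_, ?_⟩
      · rw [Set.ncard_insert_of_notMem hy.2, hXn]
      · exact Set.insert_subset (Or.inr p.end_mem_support) (hXS.trans Set.subset_union_left)
      · exact induce_union_connected hS.preconnected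
          p.connected_induce_support.preconnected ⟨x, hXS hx, p.start_mem_support⟩
      · classical
        -- The start of `p` already lies in `S`, so the walk costs at most `m` new vertices rather
        -- than `m + 1`.
        have hsub : S ∪ {v | v ∈ p.support} ⊆ S ∪ {v | v ∈ p.support.tail} := by
          rintro v (hv | hv)
          · exact Or.inl hv
          · rcases (Walk.mem_support_iff p).1 hv with rfl | hv
            · exact Or.inl (hXS hx)
            · exact Or.inr hv
        have htail : {v | v ∈ p.support.tail}.ncard ≤ p.length := by
          have : {v | v ∈ p.support.tail} = (p.support.tail.toFinset : Set V) := by ext; simp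
          rw [this, Set.ncard_coe_finset]
          exact (List.toFinset_card_le _).trans (by simp)
        calc _ ≤ _ := Set.ncard_le_ncard hsub (Set.toFinite _)
          _ ≤ _ := Set.ncard_union_le _ _
          _ ≤ (n * m + 1) + m := by omega
          _ = _ := by ring
  have hpos := (Set.ncard_pos (Set.toFinite _)).2 hK
  obtain ⟨X, hXK, hX, S, hXS, hS, hc⟩ := key (K.ncard - 1) (by omega)
  have : X = K := Set.eq_of_subset_of_ncard_le hXK (by omega) (Set.toFinite _)
  exact ⟨S, this ▸ hXS, hS, hc⟩

end Linked

/-! ### Short walks across a separator. -/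

section Separators

variable {V : Type u} {G : SimpleGraph V}

theorem Walk.sum_edges_eq_zero_of_forall {f : Sym2 V → ZMod 2} {u v : V} (p : G.Walk u v)
    (h : ∀ e ∈ p.edges, f e = 0) : (p.edges.map f).sum = 0 :=
  List.sum_eq_zero (by simpa using h)

/-- If the disjoint connected sets `C` and `D` both attach to `x₁ ∈ X₁` and `x₂ ∈ X₂`, and all
neighbours of `C` lie in `X₁ ∪ X₂`, then some walk of length at most `ℓ(G) / 2` joins `X₁` to
`X₂`. -/
theorem exists_short_walk_of_attached [Finite V] {C D X₁ X₂ : Set V}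
    (hC : ∀ a ∈ C, ∀ b ∈ C, ∃ p : G.Walk a b, ∀ v ∈ p.support, v ∈ C)
    (hD : ∀ a ∈ D, ∀ b ∈ D, ∃ p : G.Walk a b, ∀ v ∈ p.support, v ∈ D)
    (hN : ∀ a ∈ C, ∀ b, G.Adj a b → b ∉ C → b ∈ X₁ ∪ X₂)
    (h1C : Disjoint X₁ C) (h2C : Disjoint X₂ C) (hDC : Disjoint D C) (h12 : Disjoint X₁ X₂)
    {x₁ x₂ c₁ c₂ d₁ d₂ : V} (hx₁ : x₁ ∈ X₁) (hx₂ : x₂ ∈ X₂) (hc₁ : c₁ ∈ C) (hc₂ : c₂ ∈ C)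
    (hd₁ : d₁ ∈ D) (hd₂ : d₂ ∈ D) (ac₁ : G.Adj x₁ c₁) (ac₂ : G.Adj x₂ c₂)
    (ad₁ : G.Adj x₁ d₁) (ad₂ : G.Adj x₂ d₂) :
    ∃ x ∈ X₁, ∃ y ∈ X₂, ∃ p : G.Walk x y, p.length ≤ G.cycleSpaceLength / 2 := by
  classical
  by_contra! hfar
  -- The weight `f` counts, mod 2, the edges between `X₁` and `C`.
  let E : Set (Sym2 V) := {e | ∃ a ∈ X₁, ∃ b ∈ C, e = s(a, b)}
  let f : Sym2 V → ZMod 2 := E.indicator 1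
  have hf1 : ∀ {a b}, a ∈ X₁ → b ∈ C → f s(a, b) = 1 := fun ha hb =>
    Set.indicator_of_mem (show _ ∈ E from ⟨_, ha, _, hb, rfl⟩) _
  have hf0 : ∀ {a b}, (a ∈ X₁ → b ∉ C) → (b ∈ X₁ → a ∉ C) → f s(a, b) = 0 := by
    intro a b h h'
    refine Set.indicator_of_notMem ?_ _
    rintro ⟨c, hc, d, hd, he⟩
    rcases Sym2.eq_iff.1 he with ⟨rfl, rfl⟩ | ⟨rfl, rfl⟩
    · exact h hc hd
    · exact h' hc hd
  let χ : V → ZMod 2 := C.indicator 1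
  have hχ1 : ∀ {a}, a ∈ C → χ a = 1 := fun ha => Set.indicator_of_mem ha _
  have hχ0 : ∀ {a}, a ∉ C → χ a = 0 := fun ha => Set.indicator_of_notMem ha _
  -- Away from `X₂`, the set `C` can be left only through `X₁`, so `f` is the coboundary of the
  -- indicator of `C`.
  have telescope : ∀ {u v} (p : G.Walk u v), (∀ w ∈ p.support, w ∉ X₂) →
      (p.edges.map f).sum = χ u + χ v := by
    intro u v p hp
    induction p with
    | nil => simpa using (CharTwo.add_self_eq_zero _).symm
    | cons h p ih =>
      rename_i u w v
      have hu : u ∉ X₂ := hp _ (by simp)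
      have hw : w ∉ X₂ := hp _ (by simp)
      have step : f s(u, w) = χ u + χ w := by
        by_cases huC : u ∈ C <;> by_cases hwC : w ∈ C
        · rw [hχ1 huC, hχ1 hwC, hf0 (fun h' => absurd huC (h1C.notMem_of_mem_left h'))
            (fun h' => absurd hwC (h1C.notMem_of_mem_left h'))]
          decide
        · have : w ∈ X₁ := (hN u huC w h hwC).resolve_right hw
          rw [hχ1 huC, hχ0 hwC, Sym2.eq_swap, hf1 this huC, add_zero]
        · have : u ∈ X₁ := (hN w hwC u h.symm huC).resolve_right hu
          rw [hχ1 hwC, hχ0 huC, hf1 this hwC, zero_add]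
        · rw [hχ0 huC, hχ0 hwC, hf0 (fun _ => hwC) (fun _ => huC), add_zero]
      rw [Walk.edges_cons, List.map_cons, List.sum_cons, step,
        ih fun z hz => hp z (by simp [hz]), add_assoc, ← add_assoc (χ w),
        CharTwo.add_self_eq_zero, zero_add]
  have hzero : ∀ {x} (p : G.Walk x x), (p.edges.map f).sum = 0 := fun p => by
    refine p.sum_edges_eq_zero_of_short f fun x c hc hl => ?_
    by_cases h2 : ∀ w ∈ c.support, w ∉ X₂
    · rw [telescope c h2, CharTwo.add_self_eq_zero]
    -- A short cycle meeting `X₂` has no vertex in `X₁`, since half of it would be a walk excluded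
    -- by `hfar`.
    · push Not at h2
      obtain ⟨y, hy, hy2⟩ := h2
      refine c.sum_edges_eq_zero_of_forall fun e he => Set.indicator_of_notMem ?_ _
      rintro ⟨a, ha, b, -, rfl⟩
      obtain ⟨p, hp⟩ := c.exists_walk_length_le_half (c.fst_mem_support_of_mem_edges he) hy
      have := hfar a ha y hy2 p
      omega
  obtain ⟨p, hp⟩ := hC c₁ hc₁ c₂ hc₂
  obtain ⟨q, hq⟩ := hD d₂ hd₂ d₁ hd₁
  have sp : (p.edges.map f).sum = 0 := by
    refine p.sum_edges_eq_zero_of_forall fun e he => Set.indicator_of_notMem ?_ _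
    rintro ⟨a, ha, b, -, rfl⟩
    exact h1C.notMem_of_mem_left ha (hp _ (p.fst_mem_support_of_mem_edges he))
  have sq : (q.edges.map f).sum = 0 := by
    refine q.sum_edges_eq_zero_of_forall fun e he => Set.indicator_of_notMem ?_ _
    rintro ⟨a, -, b, hb, rfl⟩
    exact hDC.notMem_of_mem_left (hq _ (q.snd_mem_support_of_mem_edges he)) hb
  -- This closed walk leaves `x₁` through `C` to `x₂` and returns through `D`; only its first edge
  -- has weight 1.
  have total := hzero (Walk.cons ac₁ (p.append (Walk.cons ac₂.symm
    (Walk.cons ad₂ (q.append (Walk.cons ad₁.symm Walk.nil))))))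
  have e1 : f s(c₂, x₂) = 0 := hf0 (fun h => absurd hc₂ (h1C.notMem_of_mem_left h))
    (fun h => absurd hx₂ (h12.notMem_of_mem_left h))
  have e2 : f s(x₂, d₂) = 0 := hf0 (fun _ => hDC.notMem_of_mem_left hd₂)
    (fun _ => h2C.notMem_of_mem_left hx₂)
  have e3 : f s(d₁, x₁) = 0 := hf0 (fun _ => h1C.notMem_of_mem_left hx₁)
    (fun _ => hDC.notMem_of_mem_left hd₁)
  simp [sp, sq, e1, e2, e3, hf1 hx₁ hc₁] at total

/-- The vertex set of the component of `G - K` that contains `a` (empty if `a ∈ K`). -/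
def avoidComponent (G : SimpleGraph V) (K : Set V) (a : V) : Set V :=
  {b | ∃ p : G.Walk a b, ∀ v ∈ p.support, v ∉ K}

theorem self_mem_avoidComponent {K : Set V} {a : V} (ha : a ∉ K) : a ∈ G.avoidComponent K a :=
  ⟨Walk.nil, by simpa using ha⟩

theorem notMem_of_mem_avoidComponent {K : Set V} {a b : V} (hb : b ∈ G.avoidComponent K a) :
    b ∉ K :=
  hb.elim fun p hp => hp _ p.end_mem_support

theorem mem_avoidComponent_of_adj {K : Set V} {a b c : V} (hb : b ∈ G.avoidComponent K a)
    (h : G.Adj b c) (hc : c ∉ K) : c ∈ G.avoidComponent K a := by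
  obtain ⟨p, hp⟩ := hb
  refine ⟨p.append (Walk.cons h Walk.nil), fun v hv => ?_⟩
  rw [Walk.mem_support_append_iff] at hv
  rcases hv with hv | hv
  · exact hp v hv
  · have : v = b ∨ v = c := by simpa using hv
    rcases this with rfl | rfl
    · exact hp _ p.end_mem_support
    · exact hc

theorem mem_avoidComponent_of_walk {K : Set V} {a b c : V} (hb : b ∈ G.avoidComponent K a)
    (p : G.Walk b c) (hp : ∀ v ∈ p.support, v ∉ K) : c ∈ G.avoidComponent K a := by
  obtain ⟨q, hq⟩ := hb
  refine ⟨q.append p, fun v hv => ?_⟩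
  rw [Walk.mem_support_append_iff] at hv
  exact hv.elim (hq v) (hp v)

theorem avoidComponent_eq_of_mem {K : Set V} {a b : V} (hb : b ∈ G.avoidComponent K a) :
    G.avoidComponent K b = G.avoidComponent K a := by
  obtain ⟨p, hp⟩ := hb
  refine Set.Subset.antisymm (fun c ⟨q, hq⟩ => mem_avoidComponent_of_walk ⟨p, hp⟩ q hq)
    fun c ⟨q, hq⟩ => mem_avoidComponent_of_walk (b := a) ⟨p.reverse, by simpa using hp⟩ q hq

theorem exists_walk_avoidComponent {K : Set V} {a : V} :
    ∀ b ∈ G.avoidComponent K a, ∀ c ∈ G.avoidComponent K a,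
      ∃ p : G.Walk b c, ∀ v ∈ p.support, v ∈ G.avoidComponent K a := by
  classical
  intro b hb c hc
  rw [← avoidComponent_eq_of_mem hb] at hc ⊢
  obtain ⟨p, hp⟩ := hc
  exact ⟨p, fun v hv => ⟨p.takeUntil v hv, fun w hw =>
    hp w (p.support_takeUntil_subset_support hv hw)⟩⟩

/-- `x` has a neighbour in the set `C`. -/
def Attached (G : SimpleGraph V) (C : Set V) (x : V) : Prop := ∃ c ∈ C, G.Adj x c

/-- A set `K` is linked by walks of length at most `ℓ(G) / 2` if nonadjacent pairs in `K` attach to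
a common component of `G - K` and no such component attaches to all of `K`. -/
theorem exists_short_walk_of_pairs_attached [Finite V] {K : Set V}
    (hℓ : 2 ≤ G.cycleSpaceLength)
    (hpair : ∀ x ∈ K, ∀ y ∈ K, x ≠ y → ¬ G.Adj x y →
      ∃ a, G.Attached (G.avoidComponent K a) x ∧ G.Attached (G.avoidComponent K a) y)
    (hfull : ∀ a, ∃ z ∈ K, ¬ G.Attached (G.avoidComponent K a) z)
    {X : Set V} (hXK : X ⊆ K) (hX : X.Nonempty) (hne : X ≠ K) :
    ∃ x ∈ X, ∃ y ∈ K \ X, ∃ p : G.Walk x y, p.length ≤ G.cycleSpaceLength / 2 := by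
  obtain ⟨x, hx⟩ := hX
  obtain ⟨y, hyK, hyX⟩ := Set.exists_of_ssubset (hXK.ssubset_of_ne hne)
  have hxy : x ≠ y := by rintro rfl; exact hyX hx
  by_cases hadj : G.Adj x y
  · exact ⟨x, hx, y, ⟨hyK, hyX⟩, hadj.toWalk, by simp; omega⟩
  obtain ⟨a, hxa, hya⟩ := hpair x (hXK hx) y hyK hxy hadj
  obtain ⟨z, hzK, hz⟩ := hfull a
  set C := G.avoidComponent K a with hCdef
  -- `S` is the neighbourhood of `C`, and it misses `z`. So it separates `C` from the component of
  -- `G - S` containing `z`, which serves as the second side.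
  let S : Set V := {s | s ∈ K ∧ G.Attached C s}
  have hSK : S ⊆ K := fun _ h => h.1
  have hzS : z ∉ S := fun h => hz h.2
  have hKC : Disjoint K C :=
    Set.disjoint_left.2 fun v hv hvC => notMem_of_mem_avoidComponent hvC hv
  have hN : ∀ b ∈ C, ∀ c, G.Adj b c → c ∉ C → c ∈ S := fun b hb c hbc hc => by
    by_cases hcK : c ∈ K
    · exact ⟨hcK, b, hb, hbc.symm⟩
    · exact absurd (mem_avoidComponent_of_adj hb hbc hcK) hc
  -- If `s` and `z` are nonadjacent, they attach to a common component of `G - K`; it avoids `S ⊆ K`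
  -- and so lies in the component of `z`.
  have hD : ∀ s ∈ S, G.Attached (G.avoidComponent S z) s := by
    intro s hs
    by_cases hsz : G.Adj s z
    · exact ⟨z, self_mem_avoidComponent hzS, hsz⟩
    obtain ⟨b, ⟨c, hc, hsc⟩, ⟨d, hd, hzd⟩⟩ := hpair s hs.1 z hzK (by rintro rfl; exact hzS hs) hsz
    obtain ⟨p, hp⟩ := exists_walk_avoidComponent d hd c hc
    refine ⟨c, mem_avoidComponent_of_walk (mem_avoidComponent_of_adj
      (self_mem_avoidComponent hzS) hzd fun h => notMem_of_mem_avoidComponent hd (hSK h)) p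
      fun v hv h => notMem_of_mem_avoidComponent (hp v hv) (hSK h), hsc⟩
  have back : ∀ {u w} (p : G.Walk u w), (∀ v ∈ p.support, v ∉ S) → w ∈ C → u ∈ C := by
    intro u w p
    induction p with
    | nil => exact fun _ h => h
    | cons h p ih =>
      intro hp hw
      by_contra hu
      exact hp _ (by simp) (hN _ (ih (fun v hv => hp v (by simp [hv])) hw) _ h.symm hu)
  have hDC : Disjoint (G.avoidComponent S z) C := by
    refine Set.disjoint_left.2 ?_
    rintro d ⟨p, hp⟩ hdC
    exact hKC.notMem_of_mem_left hzK (back p hp hdC)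
  obtain ⟨c₁, hc₁, ac₁⟩ := hxa
  obtain ⟨c₂, hc₂, ac₂⟩ := hya
  have hxS : x ∈ S := ⟨hXK hx, c₁, hc₁, ac₁⟩
  have hyS : y ∈ S := ⟨hyK, c₂, hc₂, ac₂⟩
  obtain ⟨d₁, hd₁, ad₁⟩ := hD x hxS
  obtain ⟨d₂, hd₂, ad₂⟩ := hD y hyS
  obtain ⟨x', hx', y', hy', p, hp⟩ := exists_short_walk_of_attached (X₁ := S ∩ X) (X₂ := S \ X)
    exists_walk_avoidComponent exists_walk_avoidComponent
    (fun b hb c hbc hc => by rw [Set.inter_union_sdiff]; exact hN b hb c hbc hc)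
    (hKC.mono_left (Set.inter_subset_left.trans hSK)) (hKC.mono_left (Set.sdiff_subset.trans hSK))
    hDC (Set.disjoint_sdiff_right.mono_left Set.inter_subset_right) 
    ⟨hxS, hx⟩ ⟨hyS, hyX⟩ hc₁ hc₂ hd₁ hd₂ ac₁ ac₂ ad₁ ad₂
  exact ⟨x', hx'.2, y', ⟨hSK hy'.1, hy'.2⟩, p, hp⟩

end Separators

/-! ### Tree paths, and doubling a tree at a node. -/

section Trees

variable {ι : Type v} {T : SimpleGraph ι}

/-- The path is unique, hence obtained by shortening `w`. This reduces axiom (T3) to exhibiting any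
walk through suitable nodes. -/
theorem IsTree.mem_of_mem_support_path (hT : T.IsTree) {P : Set ι} {a b : ι} {w : T.Walk a b}
    (hw : ∀ t ∈ w.support, t ∈ P) {p : T.Walk a b} (hp : p.IsPath) :
    ∀ t ∈ p.support, t ∈ P := by
  classical
  intro t ht
  rw [(hT.existsUnique_path a b).unique hp w.bypass_isPath] at ht
  exact hw t (w.support_bypass_subset_support ht)

/-- Two copies of `T`, joined by an edge between the two copies of `t`. -/
def doubleAt (T : SimpleGraph ι) (t : ι) : SimpleGraph (ι ⊕ ι) :=
  (T ⊕g T) ⊔ edge (Sum.inl t) (Sum.inr t)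

/-- The first copy of `T` in `T.doubleAt t`. -/
def doubleAtInl (T : SimpleGraph ι) (t : ι) : T →g T.doubleAt t :=
  (Hom.ofLE le_sup_left).comp (Embedding.sumInl (G := T) (H := T)).toHom

/-- The second copy of `T` in `T.doubleAt t`. -/
def doubleAtInr (T : SimpleGraph ι) (t : ι) : T →g T.doubleAt t :=
  (Hom.ofLE le_sup_left).comp (Embedding.sumInr (G := T) (H := T)).toHom

theorem doubleAt_adj (T : SimpleGraph ι) (t : ι) :
    (T.doubleAt t).Adj (Sum.inl t) (Sum.inr t) := by
  simp [doubleAt, edge_adj]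

theorem IsTree.doubleAt [Finite ι] (hT : T.IsTree) (t : ι) : (T.doubleAt t).IsTree := by
  have hconn : (T.doubleAt t).Connected := by
    refine connected_iff_exists_forall_reachable _ |>.2 ⟨Sum.inl t, ?_⟩
    rintro (a | a)
    · exact (hT.connected.preconnected t a).map (T.doubleAtInl t)
    · exact (T.doubleAt_adj t).reachable.trans
        ((hT.connected.preconnected t a).map (T.doubleAtInr t))
  -- Connectedness bounds the number of edges from below; two copies of the edges of `T` plus one
  -- bound it from above.
  refine isTree_iff_connected_and_card.2 ⟨hconn, ?_⟩
  have h1 := hconn.card_vert_le_card_edgeSet_add_one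
  have h2 := (isTree_iff_connected_and_card.1 hT).2
  have h3 : Nat.card (T.doubleAt t).edgeSet ≤ Nat.card (T ⊕g T).edgeSet + 1 := by
    rw [SimpleGraph.doubleAt, edgeSet_sup]
    refine (Set.ncard_union_le _ _).trans (Nat.add_le_add_left ?_ _)
    refine (Set.ncard_le_ncard (t := {s(Sum.inl t, Sum.inr t)}) ?_ (Set.toFinite _)).trans (by simp)
    intro e he
    rw [edgeSet_edge_of_ne (by simp)] at he
    exact he
  rw [Nat.card_congr edgeSetSumEquiv, Nat.card_sum] at h3
  rw [Nat.card_sum] at h1 ⊢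
  omega

end Trees

/-! ### Tree-decompositions: enlarging a part, and splitting at a part. -/

namespace TreeDecomposition

variable {V : Type u} {G : SimpleGraph V} {ι : Type v}

theorem exists_walk_of_mem (D : TreeDecomposition G ι) {x : V} {a b : ι} (ha : x ∈ D.part a)
    (hb : x ∈ D.part b) : ∃ p : D.tree.Walk a b, ∀ t ∈ p.support, x ∈ D.part t := by
  obtain ⟨p, hp⟩ := (D.isTree.existsUnique_path a b).exists
  exact ⟨p, fun t ht => D.inter_subset_part a t b p hp ht ⟨ha, hb⟩⟩

/-- The nodes whose parts meet a connected vertex set are connected in the tree. -/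
theorem exists_walk_of_walk (D : TreeDecomposition G ι) {C : Set V} {x y : V} (p : G.Walk x y)
    (hp : ∀ v ∈ p.support, v ∈ C) {a b : ι} (ha : x ∈ D.part a) (hb : y ∈ D.part b) :
    ∃ q : D.tree.Walk a b, ∀ t ∈ q.support, (D.part t ∩ C).Nonempty := by
  induction p generalizing a with
  | nil =>
    obtain ⟨q, hq⟩ := D.exists_walk_of_mem ha hb
    exact ⟨q, fun t ht => ⟨_, hq t ht, hp _ (by simp)⟩⟩
  | cons h p ih =>
    obtain ⟨c, hc, hc'⟩ := D.exists_edge_mem_part _ _ h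
    obtain ⟨q, hq⟩ := D.exists_walk_of_mem ha hc
    obtain ⟨r, hr⟩ := ih (fun v hv => hp v (by simp [hv])) hc' hb
    refine ⟨q.append r, fun t ht => ?_⟩
    rw [Walk.mem_support_append_iff] at ht
    rcases ht with ht | ht
    · exact ⟨_, hq t ht, hp _ (by simp)⟩
    · exact hr t ht

/-- If every vertex of a part has a neighbour in a connected set `C`, then some part contains that
part and meets `C`. -/
theorem exists_part_of_attached (D : TreeDecomposition G ι) {C : Set V} (hne : C.Nonempty)
    (hC : ∀ a ∈ C, ∀ b ∈ C, ∃ p : G.Walk a b, ∀ v ∈ p.support, v ∈ C) {t : ι}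
    (ht : ∀ x ∈ D.part t, G.Attached C x) :
    ∃ s, D.part t ⊆ D.part s ∧ (D.part s ∩ C).Nonempty := by
  classical
  let N : Set ι := {s | (D.part s ∩ C).Nonempty}
  have hN : N.Nonempty := by
    obtain ⟨c, hc⟩ := hne
    obtain ⟨s, hs⟩ := D.exists_mem_part c
    exact ⟨s, c, hs, hc⟩
  -- Take `s` nearest to `t` among the nodes whose parts meet `C`. Any `x` in the part at `t` shares
  -- a part with a neighbour in `C`, at a node `n`, and `s` will lie on the tree path from `t` to
  -- `n`.
  obtain ⟨s, hs, hmin⟩ := exists_minimalFor_of_wellFoundedLT (· ∈ N) (D.tree.dist t) hN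
  refine ⟨s, fun x hx => ?_, hs⟩
  obtain ⟨c, hc, hxc⟩ := ht x hx
  obtain ⟨n, hxn, hcn⟩ := D.exists_edge_mem_part _ _ hxc
  obtain ⟨d, hds, hd⟩ := hs
  obtain ⟨r, hr⟩ := hC d hd c hc
  obtain ⟨q, hq⟩ := D.exists_walk_of_walk r hr hds hcn
  obtain ⟨p, hp, hpl⟩ := (D.isTree.connected.preconnected t s).exists_path_of_dist
  -- All nodes of `q` lie in `N`, while `p` meets `N` only in its end `s` by minimality of the
  -- distance.
  have hpath : (p.append q.bypass).IsPath := by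
    rw [Walk.isPath_def, Walk.support_append, List.nodup_append']
    refine ⟨hp.support_nodup, q.bypass_isPath.support_nodup.tail, ?_⟩
    intro m hm hm'
    have hmN : m ∈ N := hq m (q.support_bypass_subset_support (List.mem_of_mem_tail hm'))
    have h1 : D.tree.dist t s ≤ D.tree.dist t m := by
      rcases le_total (D.tree.dist t s) (D.tree.dist t m) with h | h
      · exact h
      · exact hmin hmN h
    have h2 := dist_le (p.takeUntil m hm)
    have h3 := congrArg Walk.length (p.take_spec hm)
    rw [Walk.length_append] at h3
    have h4 : (p.dropUntil m hm).length = 0 := by omega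
    obtain rfl := Walk.eq_of_length_eq_zero h4
    have := q.bypass_isPath.support_nodup
    rw [← Walk.cons_tail_support, List.nodup_cons] at this
    exact this.1 hm'
  exact D.inter_subset_part t s n _ hpath
    ((Walk.mem_support_append_iff _ _).2 (Or.inl p.end_mem_support)) ⟨hx, hxn⟩

/-- The ordered pairs of vertices that lie in a common part. -/
def pairs (D : TreeDecomposition G ι) : Set (V × V) :=
  {e | ∃ t, e.1 ∈ D.part t ∧ e.2 ∈ D.part t}

/-- Given vertex sets `A`, `B` that together contain every vertex and both ends of every edge, and
whose intersection lies in the part at `t`, take one copy of `D` restricted to `A` and one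
restricted to `B` and join them at `t`. -/
def split [Finite ι] (D : TreeDecomposition G ι) (t : ι) (A B : Set V)
    (hv : ∀ x, x ∈ A ∨ x ∈ B) (he : ∀ x y, G.Adj x y → (x ∈ A ∧ y ∈ A) ∨ (x ∈ B ∧ y ∈ B))
    (hAB : A ∩ B ⊆ D.part t) : TreeDecomposition G (ι ⊕ ι) where
  tree := D.tree.doubleAt t
  isTree := D.isTree.doubleAt t
  part := Sum.elim (fun s => D.part s ∩ A) (fun s => D.part s ∩ B)
  exists_mem_part x := by
    obtain ⟨s, hs⟩ := D.exists_mem_part x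
    exact (hv x).elim (fun h => ⟨Sum.inl s, hs, h⟩) (fun h => ⟨Sum.inr s, hs, h⟩)
  exists_edge_mem_part x y h := by
    obtain ⟨s, hs, hs'⟩ := D.exists_edge_mem_part x y h
    exact (he x y h).elim (fun h => ⟨Sum.inl s, ⟨hs, h.1⟩, hs', h.2⟩)
      (fun h => ⟨Sum.inr s, ⟨hs, h.1⟩, hs', h.2⟩)
  inter_subset_part := by
    rintro a b c p hp hb x ⟨hxa, hxc⟩
    have inl : ∀ {a c}, x ∈ D.part a → x ∈ D.part c → x ∈ A →
        ∃ w : (D.tree.doubleAt t).Walk (Sum.inl a) (Sum.inl c), ∀ s ∈ w.support,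
          x ∈ Sum.elim (fun s => D.part s ∩ A) (fun s => D.part s ∩ B) s := by
      intro a c ha hc hA
      obtain ⟨w, hw⟩ := D.exists_walk_of_mem ha hc
      refine ⟨w.map (D.tree.doubleAtInl t), fun s hs => ?_⟩
      obtain ⟨r, hr, rfl⟩ := List.mem_map.1
        ((congrArg (s ∈ ·) (Walk.support_map (D.tree.doubleAtInl t) w)).mp hs)
      exact ⟨hw r hr, hA⟩
    have inr : ∀ {a c}, x ∈ D.part a → x ∈ D.part c → x ∈ B →
        ∃ w : (D.tree.doubleAt t).Walk (Sum.inr a) (Sum.inr c), ∀ s ∈ w.support,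
          x ∈ Sum.elim (fun s => D.part s ∩ A) (fun s => D.part s ∩ B) s := by
      intro a c ha hc hB
      obtain ⟨w, hw⟩ := D.exists_walk_of_mem ha hc
      refine ⟨w.map (D.tree.doubleAtInr t), fun s hs => ?_⟩
      obtain ⟨r, hr, rfl⟩ := List.mem_map.1
        ((congrArg (s ∈ ·) (Walk.support_map (D.tree.doubleAtInr t) w)).mp hs)
      exact ⟨hw r hr, hB⟩
    have cross : ∀ {a c}, x ∈ D.part a → x ∈ D.part c → x ∈ A → x ∈ B →
        ∃ w : (D.tree.doubleAt t).Walk (Sum.inl a) (Sum.inr c), ∀ s ∈ w.support,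
          x ∈ Sum.elim (fun s => D.part s ∩ A) (fun s => D.part s ∩ B) s := by
      intro a c ha hc hA hB
      have ht := hAB ⟨hA, hB⟩
      obtain ⟨w, hw⟩ := inl ha ht hA
      obtain ⟨w', hw'⟩ := inr ht hc hB
      refine ⟨w.append (Walk.cons (D.tree.doubleAt_adj t) w'), fun s hs => ?_⟩
      rw [Walk.mem_support_append_iff, Walk.support_cons, List.mem_cons] at hs
      rcases hs with hs | rfl | hs
      · exact hw s hs
      · exact ⟨ht, hA⟩
      · exact hw' s hs
    have walk : ∃ w : (D.tree.doubleAt t).Walk a c, ∀ s ∈ w.support,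
        x ∈ Sum.elim (fun s => D.part s ∩ A) (fun s => D.part s ∩ B) s := by
      rcases a with a | a <;> rcases c with c | c
      · exact inl hxa.1 hxc.1 hxa.2
      · exact cross hxa.1 hxc.1 hxa.2 hxc.2
      · obtain ⟨w, hw⟩ := cross hxc.1 hxa.1 hxc.2 hxa.2
        exact ⟨w.reverse, by simpa using hw⟩
      · exact inr hxa.1 hxc.1 hxa.2
    obtain ⟨w, hw⟩ := walk
    exact (D.isTree.doubleAt t).mem_of_mem_support_path 
      (P := {s | x ∈ Sum.elim (fun s => D.part s ∩ A) (fun s => D.part s ∩ B) s}) hw hp b hb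

/-- In a tree-decomposition with parts of at most `n` vertices and with the fewest pairs of
vertices in common parts, any two nonadjacent vertices of a part `K` attach to a common component
of `G - K`. -/
theorem exists_attached_of_minimal [Finite V] {ι : Type u} [Finite ι] (D : TreeDecomposition G ι)
    {n : ℕ} (hn : ∀ t, (D.part t).ncard ≤ n)
    (hmin : ∀ (κ : Type u) [Finite κ] (D' : TreeDecomposition G κ),
      (∀ t, (D'.part t).ncard ≤ n) → D.pairs.ncard ≤ D'.pairs.ncard)
    {t : ι} {x y : V} (hx : x ∈ D.part t) (hy : y ∈ D.part t) (hxy : x ≠ y)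
    (hadj : ¬ G.Adj x y) :
    ∃ a, G.Attached (G.avoidComponent (D.part t) a) x ∧
      G.Attached (G.avoidComponent (D.part t) a) y := by
  by_contra! hno
  set K := D.part t
  -- Components of `G - K` attached to `x` go to `B`, the others to `A`. By `hno` those in `B` are
  -- not attached to `y`, so `x` can be dropped from `A` and `y` from `B`.
  let A : Set V := {v | v ≠ x ∧ (v ∉ K → ¬ G.Attached (G.avoidComponent K v) x)}
  let B : Set V := {v | v ≠ y ∧ (v ∉ K → G.Attached (G.avoidComponent K v) x)}
  have hv : ∀ v, v ∈ A ∨ v ∈ B := by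
    intro v
    by_cases hvK : v ∈ K
    · by_cases hvx : v = x
      · exact Or.inr ⟨hvx ▸ hxy, fun h => absurd hvK h⟩
      · exact Or.inl ⟨hvx, fun h => absurd hvK h⟩
    · by_cases h : G.Attached (G.avoidComponent K v) x
      · exact Or.inr ⟨by rintro rfl; exact hvK hy, fun _ => h⟩
      · exact Or.inl ⟨by rintro rfl; exact hvK hx, fun _ => h⟩
  have outside : ∀ v w, G.Adj v w → v ∉ K → (v ∈ A ∧ w ∈ A) ∨ (v ∈ B ∧ w ∈ B) := by
    intro v w hvw hvK
    have hvx : v ≠ x := by rintro rfl; exact hvK hx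
    have hvy : v ≠ y := by rintro rfl; exact hvK hy
    have hself := self_mem_avoidComponent (G := G) hvK
    have hsame : w ∉ K → G.avoidComponent K w = G.avoidComponent K v := fun hw =>
      avoidComponent_eq_of_mem (mem_avoidComponent_of_adj hself hvw hw)
    by_cases h : G.Attached (G.avoidComponent K v) x
    · refine Or.inr ⟨⟨hvy, fun _ => h⟩, ?_, fun hw => (hsame hw).symm ▸ h⟩
      rintro rfl
      exact hno v h ⟨v, hself, hvw.symm⟩
    · refine Or.inl ⟨⟨hvx, fun _ => h⟩, ?_, fun hw => (hsame hw).symm ▸ h⟩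
      rintro rfl
      exact h ⟨v, hself, hvw.symm⟩
  have he : ∀ v w, G.Adj v w → (v ∈ A ∧ w ∈ A) ∨ (v ∈ B ∧ w ∈ B) := by
    intro v w hvw
    by_cases hvK : v ∈ K
    · by_cases hwK : w ∈ K
      · have hA : ∀ z ∈ K, z ≠ x → z ∈ A := fun z hz h => ⟨h, fun h' => absurd hz h'⟩
        have hB : ∀ z ∈ K, z ≠ y → z ∈ B := fun z hz h => ⟨h, fun h' => absurd hz h'⟩
        by_cases h : v = x ∨ w = x
        · refine Or.inr ⟨hB v hvK ?_, hB w hwK ?_⟩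
          · rintro rfl
            rcases h with rfl | rfl
            · exact hxy rfl
            · exact hadj hvw.symm
          · rintro rfl
            rcases h with rfl | rfl
            · exact hadj hvw
            · exact hxy rfl
        · push Not at h
          exact Or.inl ⟨hA v hvK h.1, hA w hwK h.2⟩
      · exact (outside w v hvw.symm hwK).imp And.symm And.symm
    · exact outside v w hvw hvK
  have hAB : A ∩ B ⊆ K := by
    rintro v ⟨hA, hB⟩
    by_contra hvK
    exact hA.2 hvK (hB.2 hvK)
  let D' := D.split t A B hv he hAB
  have hD' : ∀ s, ∃ r, D'.part s ⊆ D.part r := by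
    rintro (s | s)
    · exact ⟨s, Set.inter_subset_left⟩
    · exact ⟨s, Set.inter_subset_left⟩
  have hle := hmin (ι ⊕ ι) D' fun s => by
    obtain ⟨r, hr⟩ := hD' s
    exact (Set.ncard_le_ncard hr (Set.toFinite _)).trans (hn r)
  -- Every new part lies in an old one, and the pair `(x, y)` is lost.
  refine hle.not_gt (Set.ncard_lt_ncard ?_ (Set.toFinite _))
  refine (Set.ssubset_iff_of_subset ?_).2 ⟨(x, y), ⟨t, hx, hy⟩, ?_⟩
  · rintro ⟨v, w⟩ ⟨s, h1, h2⟩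
    obtain ⟨r, hr⟩ := hD' s
    exact ⟨r, hr h1, hr h2⟩
  · rintro ⟨s | s, h1, h2⟩
    · exact h1.2.1 rfl
    · exact h2.2.1 rfl

end TreeDecomposition
end SimpleGraph

/-! ### The bound on the weak connected tree-width. -/

open SimpleGraph in
theorem mainTheorem2 {V : Type*} [Finite V] (G : SimpleGraph V)
    (hG : ∃ (x : V) (c : G.Walk x x), c.IsCycle) :
    G.weakConnectedTreeWidth ≤ G.treeWidth * (G.cycleSpaceLength / 2) := by
  obtain ⟨x₀, c, hc⟩ := hG
  have hℓ := three_le_cycleSpaceLength hc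
  let P : ℕ → Prop := fun k => ∃ (ι : Type _) (_ : Finite ι) (D : TreeDecomposition G ι),
    (∀ t, (D.part t).ncard ≤ G.treeWidth + 1) ∧ D.pairs.ncard = k
  have hP : ∃ k, P k := by
    obtain ⟨ι, _, D, hD⟩ := exists_width_eq_treeWidth G
    refine ⟨_, ι, inferInstance, D, fun t => ?_, rfl⟩
    have : (D.part t).ncard - 1 ≤ D.width :=
      le_ciSup (f := fun t => (D.part t).ncard - 1) (Set.finite_range _).bddAbove t
    omega
  classical
  obtain ⟨ι, _, D, hn, hk⟩ := Nat.find_spec hP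
  have hmin : ∀ (κ : Type _) [Finite κ] (D' : TreeDecomposition G κ),
      (∀ t, (D'.part t).ncard ≤ G.treeWidth + 1) → D.pairs.ncard ≤ D'.pairs.ncard :=
    fun κ _ D' h => hk ▸ Nat.find_min' hP ⟨κ, inferInstance, D', h, rfl⟩
  refine Nat.sInf_le ⟨ι, inferInstance, D, fun t => ?_⟩
  -- A connected set containing a larger part serves for the part at `t` too, so an
  -- inclusion-maximal part may be taken.
  obtain ⟨s, hts, hs⟩ : ∃ s, D.part t ⊆ D.part s ∧ ∀ r, D.part s ⊆ D.part r →
      D.part r ⊆ D.part s := by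
    obtain ⟨K, hK, hmax⟩ := (Set.finite_range D.part).exists_le_maximal (Set.mem_range_self t)
    obtain ⟨s, rfl⟩ := hmax.prop
    exact ⟨s, hK, fun r hr => hmax.2 (Set.mem_range_self r) hr⟩
  rcases (D.part s).eq_empty_or_nonempty with h0 | hne
  · refine ⟨{x₀}, hts.trans (h0 ▸ Set.empty_subset _), by simp, by simp⟩
  obtain ⟨S, hS, hconn, hcard⟩ := exists_connected_superset (G := G) hne fun X hXK hX hXne =>
    exists_short_walk_of_pairs_attached (by omega)
      (fun x hx y hy hxy hadj => D.exists_attached_of_minimal hn hmin hx hy hxy hadj)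
      (fun a => by
        by_contra! hall
        have hCne : (G.avoidComponent (D.part s) a).Nonempty := by
          obtain ⟨z, hz⟩ := hne
          obtain ⟨c, hc, -⟩ := hall z hz
          exact ⟨c, hc⟩
        obtain ⟨r, hr, v, hv, hvC⟩ :=
          D.exists_part_of_attached hCne exists_walk_avoidComponent hall
        exact notMem_of_mem_avoidComponent hvC (hs r hr hv)) hXK hX hXne
  refine ⟨S, hts.trans hS, hconn, hcard.trans ?_⟩
  have := hn s
  gcongr
  omega
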